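/- Let $f=\frac1n\sum_{i=1}^n f_i$, where each $f_i:\mathbb R^m\to\mathbb R$ is convex and differentiable with $L$-Lipschitz gradient, and let $b\ge 1$ be an integer with $b\le n/3$. Sampling. On a probability space with a filtration $(\mathcal F_k)_{k\ge0}$, let the mini-batches $J_0,J_1,\dots$ be such that $J_k$ is uniformly distributed on the subsets of $\{1,\dots,n\}$ of cardinality $b$, is independent of $\mathcal F_k$, and is $\mathcal F_{k+1}$-measurable. Let $x_0,x_1,x_2,\dots$ be any sequence of random points of $\mathbb R^m$ such that $x_0$ is $\mathcal F_0$-measurable, $x_{k+1}$ is $\mathcal F_k$-measurable for every $k\ge0$, and $\mathbb E\|\nabla f_i(x_k)\|^2<\infty$ for all $i,k$. Write $\mathbb E_k=\mathbb E[\,\cdot\mid\mathcal F_k]$. Estimator. The SARGE estimator is defined by $\widetilde\nabla_0=\nabla f(x_0)$, $\psi_0^i=\nabla f_i(x_0)-(1-\frac bn)\nabla f_i(x_0)$ and, for $k\ge0$, $$\widetilde\nabla_{k+1}=\frac1b\sum_{j\in J_k}\bigl(\nabla f_j(x_{k+1})-\psi_k^j\bigr)+\frac1n\sum_{i=1}^n\psi_k^i-\Bigl(1-\frac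 bn\Bigr)\Bigl(\frac1b\sum_{j\in J_k}\nabla f_j(x_k)-\widetilde\nabla_k\Bigr),$$ where $\psi_{k+1}^j=\nabla f_j(x_{k+1})-(1-\frac bn)\nabla f_j(x_k)$ for $j\in J_k$ and $\psi_{k+1}^i=\psi_k^i$ for $i\notin J_k$. Claim. The SARGE estimator satisfies the MSEB$(M_1,M_2,\rho_M,\rho_B,\rho_F)$ property with $$M_1=12,\quad M_2=\frac{27+12b}{n^2},\quad \rho_M=\frac b{2n},\quad \rho_B=\frac bn,\quad \rho_F=\frac b{2n}.$$ That is, $M_1,M_2\ge0$, $\rho_M,\rho_B,\rho_F\in(0,1]$, every $\widetilde\nabla_k$ is square integrable, and there are real sequences $(\mathcal M_k)_{k\ge0}$, $(\mathcal F'_k)_{k\ge0}$ such that, with $\mathcal M_{-1}=0$, for every $k\ge0$: $$\nabla f(x_{k+1})-\mathbb E_k\widetilde\nabla_{k+1}=(1-\rho_B)\bigl(\nabla f(x_k)-\widetilde\nabla_k\bigr)\quad\text{almost surely},$$ $$\mathbb E\|\widetilde\nabla_{k+1}-\nabla f(x_{k+1})\|^2\le\mathcal M_k,$$ $$\mathcal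 M_k\le\frac{M_1}n\sum_{i=1}^n\mathbb E\|\nabla f_i(x_{k+1})-\nabla f_i(x_k)\|^2+\mathcal F'_k+(1-\rho_M)\mathcal M_{k-1},$$ $$\mathcal F'_k\le\sum_{\ell=0}^k\frac{M_2(1-\rho_F)^{k-\ell}}n\sum_{i=1}^n\mathbb E\|\nabla f_i(x_{\ell+1})-\nabla f_i(x_\ell)\|^2 .$$ -/

import Mathlib

open MeasureTheory ProbabilityTheory
open scoped NNReal

noncomputable section

/-- The finite-sum objective `f = (1/n) ∑ᵢ fᵢ`. -/
def finiteSum {n m : ℕ} (f : Fin n → EuclideanSpace ℝ (Fin m) → ℝ)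
    (y : EuclideanSpace ℝ (Fin m)) : ℝ :=
  (1 / (n : ℝ)) * ∑ i, f i y

/-- The stored vectors `ψ_k^i` of SARGE along a sequence of points `x₀, x₁, …` and of mini-batches
`J₀, J₁, …`:  `ψ_{k+1}^j = ∇f_j(x_{k+1}) - (1 - b/n) ∇f_j(x_k)` for `j ∈ J_k`, and
`ψ_{k+1}^i = ψ_k^i` for the other indices. The table starts from the same formula with both points
equal to `x₀`, that is `ψ_0^i = ∇f_i(x₀) - (1 - b/n) ∇f_i(x₀)`. -/
def sargeTable {n m : ℕ} (f : Fin n → EuclideanSpace ℝ (Fin m) → ℝ) (b : ℕ)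
    (x : ℕ → EuclideanSpace ℝ (Fin m)) (J : ℕ → Finset (Fin n)) :
    ℕ → Fin n → EuclideanSpace ℝ (Fin m)
  | 0, i => gradient (f i) (x 0) - (1 - (b : ℝ) / n) • gradient (f i) (x 0)
  | k + 1, i =>
    if i ∈ J k then gradient (f i) (x (k + 1)) - (1 - (b : ℝ) / n) • gradient (f i) (x k)
    else sargeTable f b x J k i

/-- The SARGE gradient estimator along a sequence of points and of mini-batches; `sarge f b x J k`
estimates `∇f(x_k)`, and the recursion starts from the full gradient at `x₀`. -/
def sarge {n m : ℕ} (f : Fin n → EuclideanSpace ℝ (Fin m) → ℝ) (b : ℕ)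
    (x : ℕ → EuclideanSpace ℝ (Fin m)) (J : ℕ → Finset (Fin n)) :
    ℕ → EuclideanSpace ℝ (Fin m)
  | 0 => gradient (finiteSum f) (x 0)
  | k + 1 =>
    (1 / (b : ℝ)) • (∑ j ∈ J k, (gradient (f j) (x (k + 1)) - sargeTable f b x J k j))
      + (1 / (n : ℝ)) • (∑ i, sargeTable f b x J k i)
      - (1 - (b : ℝ) / n) •
        ((1 / (b : ℝ)) • (∑ j ∈ J k, gradient (f j) (x k)) - sarge f b x J k)

/-- `J₀, J₁, …` are mini-batches of size `b`, drawn afresh at every step: `J_k` is uniform on the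
`b`-element subsets of the index set and independent of the information `ℱ k` that is available
before it is drawn; it is known at time `k + 1`. -/
structure IsMinibatchSampling {Ω : Type*} [MeasurableSpace Ω] (μ : Measure Ω)
    (ℱ : Filtration ℕ ‹MeasurableSpace Ω›) {n : ℕ} (b : ℕ)
    (J : ℕ → Ω → Finset (Fin n)) : Prop where
  measurable_next : ∀ k, Measurable[ℱ (k + 1), (⊤ : MeasurableSpace (Finset (Fin n)))] (J k)
  indep_past : ∀ k,
    Indep (MeasurableSpace.comap (J k) (⊤ : MeasurableSpace (Finset (Fin n)))) (ℱ k) μ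
  card_eq : ∀ k, ∀ᵐ ω ∂μ, (J k ω).card = b
  uniform : ∀ k, ∀ S : Finset (Fin n), S.card = b →
    μ.real {ω | J k ω = S} = 1 / (n.choose b : ℝ)

/-- `(1/n) ∑ᵢ E‖∇fᵢ(x_{k+1}) - ∇fᵢ(x_k)‖²`. -/
def meanSqGradDiff {Ω : Type*} [MeasurableSpace Ω] (μ : Measure Ω) {n m : ℕ}
    (f : Fin n → EuclideanSpace ℝ (Fin m) → ℝ) (x : ℕ → Ω → EuclideanSpace ℝ (Fin m))
    (k : ℕ) : ℝ :=
  (1 / (n : ℝ)) *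
    ∑ i, ∫ ω, ‖gradient (f i) (x (k + 1) ω) - gradient (f i) (x k ω)‖ ^ 2 ∂μ

/-- The MSEB property with constants `M₁, M₂, ρ_M, ρ_B, ρ_F` of the estimators `g k` of `∇f(x_k)`
along the random points `x k`. The conditional expectation `E_k` is taken given `ℱ k`. The sequence
`𝓜` starts from `𝓜_{-1} = 0`. The first two clauses say that all expectations involved are those
of integrable functions. -/
def IsMSEB {Ω : Type*} [MeasurableSpace Ω] (μ : Measure Ω)
    (ℱ : Filtration ℕ ‹MeasurableSpace Ω›) {n m : ℕ}
    (f : Fin n → EuclideanSpace ℝ (Fin m) → ℝ)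
    (x g : ℕ → Ω → EuclideanSpace ℝ (Fin m)) (M₁ M₂ ρM ρB ρF : ℝ) : Prop :=
  (∀ i k, MemLp (fun ω => gradient (f i) (x k ω)) 2 μ) ∧
  (∀ k, MemLp (g k) 2 μ) ∧
  0 ≤ M₁ ∧ 0 ≤ M₂ ∧ ρM ∈ Set.Ioc (0 : ℝ) 1 ∧ ρB ∈ Set.Ioc (0 : ℝ) 1 ∧ ρF ∈ Set.Ioc (0 : ℝ) 1 ∧
  (∀ k, ∀ᵐ ω ∂μ, gradient (finiteSum f) (x (k + 1) ω) - (μ[g (k + 1) | ℱ k]) ω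
      = (1 - ρB) • (gradient (finiteSum f) (x k ω) - g k ω)) ∧
  ∃ 𝓜 𝓕 : ℕ → ℝ,
    (∀ k, ∫ ω, ‖g (k + 1) ω - gradient (finiteSum f) (x (k + 1) ω)‖ ^ 2 ∂μ ≤ 𝓜 k) ∧
    𝓜 0 ≤ M₁ * meanSqGradDiff μ f x 0 + 𝓕 0 ∧
    (∀ k, 𝓜 (k + 1) ≤ M₁ * meanSqGradDiff μ f x (k + 1) + 𝓕 (k + 1) + (1 - ρM) * 𝓜 k) ∧
    (∀ k, 𝓕 k ≤
      ∑ l ∈ Finset.range (k + 1), M₂ * (1 - ρF) ^ (k - l) * meanSqGradDiff μ f x l)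

end

/-! Write `p = b/n`, and let `e_k` be the error of the estimator at `x_k`. The recursion gives
`e_{k+1} =` (batch mean minus full mean of the innovations) `+ (1 - p) e_k`. Given the past, the
centred batch mean has expectation zero. Hence the bias shrinks by exactly `1 - p`
(`condExp_sarge_succ`), and the second moment splits without a cross term into a sampling variance,
at most `1/(bn)` times the sum of the squared innovations, plus `(1 - p)² ‖e_k‖²`
(`subsetAverage_norm_batch_error_sq_le`).

To control the innovations, a ghost table (`sargeMemory`) records the plain gradients at the last
draws. Each innovation is then the current gradient difference, minus the gradient difference stored
at the last draw of `i`, plus `p` times the age `∇f_i(x_k) - memory`. The stored difference is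
refreshed with probability `p`, so its mean square `H` obeys a recursion with input weight `p` and
factor `1 - p`. The age obeys one with input weight `2/p` and factor `1 - p/2`, by Young's
inequality; the factor `p²` in front of its square absorbs the `1/p`.

With `s` the sum of the mean square gradient differences discounted at rate `1 - p/2`, this gives `H
≤ p s` and `p² R ≤ 2 p s`, where `R` is the mean square age. The contraction `(1 - p)²` leaves room
for these terms of order `p s`, so the mean square error stays below `12 s`
(`error_le_discountedSum`). The geometric sum itself serves as the MSEB sequence. -/

/-- The average of `φ S` over the `b`-element subsets `S` of `Fin n`. -/
noncomputable def subsetAverage {n : ℕ} {E : Type*} [AddCommGroup E] [Module ℝ E] (b : ℕ)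
    (φ : Finset (Fin n) → E) : E :=
  ((n.choose b : ℝ))⁻¹ • ∑ S ∈ Finset.powersetCard b Finset.univ, φ S

/-! ### Uniform averages over subsets of fixed size: inclusion probabilities and linearity. -/

section SubsetAverage

variable {n b : ℕ} {E : Type*} [AddCommGroup E] [Module ℝ E]

theorem subsetAverage_congr {φ φ' : Finset (Fin n) → E}
    (h : ∀ S : Finset (Fin n), S.card = b → φ S = φ' S) :
    subsetAverage b φ = subsetAverage b φ' := by
  unfold subsetAverage
  rw [Finset.sum_congr rfl fun S hS => h S (Finset.mem_powersetCard_univ.1 hS)]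

theorem subsetAverage_add (φ φ' : Finset (Fin n) → E) :
    subsetAverage b (fun S => φ S + φ' S) = subsetAverage b φ + subsetAverage b φ' := by
  simp [subsetAverage, Finset.sum_add_distrib]

theorem subsetAverage_smul (c : ℝ) (φ : Finset (Fin n) → E) :
    subsetAverage b (fun S => c • φ S) = c • subsetAverage b φ := by
  simp only [subsetAverage, ← Finset.smul_sum]
  rw [smul_comm]

theorem subsetAverage_sum {ι : Type*} (s : Finset ι) (φ : ι → Finset (Fin n) → E) :
    subsetAverage b (fun S => ∑ i ∈ s, φ i S) = ∑ i ∈ s, subsetAverage b (φ i) := by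
  simp only [subsetAverage, ← Finset.smul_sum]
  rw [Finset.sum_comm]

theorem subsetAverage_const (hbn : b ≤ n) (v : E) :
    subsetAverage b (fun _ : Finset (Fin n) => v) = v := by
  have : (n.choose b : ℝ) ≠ 0 := by exact_mod_cast (Nat.choose_pos hbn).ne'
  simp [subsetAverage, ← Nat.cast_smul_eq_nsmul ℝ, smul_smul, this]

theorem subsetAverage_smul_right (w : Finset (Fin n) → ℝ) (v : E) :
    subsetAverage b (fun S => w S • v) = subsetAverage b w • v := by
  simp [subsetAverage, ← Finset.sum_smul, smul_smul]

theorem subsetAverage_mem (hb : 1 ≤ b) (hbn : b ≤ n) (j : Fin n) :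
    subsetAverage b (fun S : Finset (Fin n) => if j ∈ S then (1 : ℝ) else 0) = b / n := by
  have h := Finset.card_filter_powersetCard_subset {j} Finset.univ b (Finset.subset_univ _)
    (by simpa using hb)
  simp only [Finset.singleton_subset_iff, Finset.card_singleton, Finset.card_univ,
    Fintype.card_fin] at h
  obtain ⟨n, rfl⟩ : ∃ k, n = k + 1 := ⟨n - 1, by lia⟩
  obtain ⟨b, rfl⟩ : ∃ k, b = k + 1 := ⟨b - 1, by lia⟩
  have hc : ((n + 1).choose (b + 1) : ℝ) ≠ 0 := by exact_mod_cast (Nat.choose_pos hbn).ne'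
  have hm := Nat.add_one_mul_choose_eq n b
  simp only [subsetAverage, Finset.sum_boole, h, Nat.add_sub_cancel, smul_eq_mul]
  have hm' : ((n + 1 : ℕ) : ℝ) * n.choose b = (n + 1).choose (b + 1) * ((b + 1 : ℕ) : ℝ) := by
    exact_mod_cast hm
  have hn : ((n + 1 : ℕ) : ℝ) ≠ 0 := by positivity
  field_simp
  linarith

/-- The variance bound needs only that the pair inclusion probability is nonnegative and the same
for all pairs; its value plays no role. -/
theorem exists_subsetAverage_mem_and_mem (n b : ℕ) :
    ∃ c : ℝ, 0 ≤ c ∧ ∀ i j : Fin n, i ≠ j →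
      subsetAverage b (fun S : Finset (Fin n) => if i ∈ S ∧ j ∈ S then (1 : ℝ) else 0) = c := by
  -- The case split guards against truncated subtraction: for `b ≤ 1` no pair fits into a batch,
  -- while `(n - 2).choose (b - 2)` would be `1`.
  refine ⟨(n.choose b : ℝ)⁻¹ * (if 2 ≤ b then ((n - 2).choose (b - 2) : ℝ) else 0), by positivity,
    fun i j hij => ?_⟩
  simp only [subsetAverage, Finset.sum_boole, smul_eq_mul]
  congr 1
  split_ifs with hb
  · have h := Finset.card_filter_powersetCard_subset {i, j} Finset.univ b (Finset.subset_univ _)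
      (by rwa [Finset.card_pair hij])
    simpa [Finset.insert_subset_iff, Finset.card_pair hij] using h
  · simp only [Nat.cast_eq_zero, Finset.card_eq_zero, Finset.filter_eq_empty_iff,
      Finset.mem_powersetCard_univ]
    rintro S hS ⟨hi, hj⟩
    have := Finset.card_le_card (show {i, j} ⊆ S by simp [Finset.insert_subset_iff, hi, hj])
    rw [Finset.card_pair hij] at this
    lia

theorem subsetAverage_ite_mem (hb : 1 ≤ b) (hbn : b ≤ n) (j : Fin n) (u v : E) :
    subsetAverage b (fun S : Finset (Fin n) => if j ∈ S then u else v)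
      = ((b : ℝ) / n) • u + (1 - (b : ℝ) / n) • v := by
  have h : (fun S : Finset (Fin n) => if j ∈ S then u else v)
      = fun S => (if j ∈ S then (1 : ℝ) else 0) • (u - v) + v := by
    ext S; split_ifs <;> simp
  rw [h, subsetAverage_add, subsetAverage_const hbn, subsetAverage_smul_right,
    subsetAverage_mem hb hbn]
  module

theorem subsetAverage_sum_mem (hb : 1 ≤ b) (hbn : b ≤ n) (u : Fin n → E) :
    subsetAverage b (fun S : Finset (Fin n) => ∑ j ∈ S, u j) = ((b : ℝ) / n) • ∑ j, u j := by
  have h : (fun S : Finset (Fin n) => ∑ j ∈ S, u j) = fun S => ∑ j, if j ∈ S then u j else 0 := by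
    ext S; simp
  rw [h, subsetAverage_sum, Finset.smul_sum]
  exact Finset.sum_congr rfl fun j _ => by simp [subsetAverage_ite_mem hb hbn]

end SubsetAverage

/-! ### Variance of a mini-batch mean. -/

section Variance

variable {n b : ℕ} {E : Type*} [NormedAddCommGroup E] [InnerProductSpace ℝ E]

/-- Expand the square. All off-diagonal inner products carry the same weight `c`, and the full
double sum is `‖∑ u_j‖² = 0`, so only the diagonal with weight `b/n - c ≤ b/n` survives. -/
theorem subsetAverage_norm_sum_sq_le (hb : 1 ≤ b) (hbn : b ≤ n) (u : Fin n → E)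
    (hu : ∑ j, u j = 0) :
    subsetAverage b (fun S : Finset (Fin n) => ‖∑ j ∈ S, u j‖ ^ 2)
      ≤ (b : ℝ) / n * ∑ j, ‖u j‖ ^ 2 := by
  obtain ⟨c, hc, hcp⟩ := exists_subsetAverage_mem_and_mem n b
  have h1 : (fun S : Finset (Fin n) => ‖∑ j ∈ S, u j‖ ^ 2)
      = fun S => ∑ i, ∑ j, (if i ∈ S ∧ j ∈ S then (1 : ℝ) else 0) • inner ℝ (u i) (u j) := by
    ext S
    rw [← real_inner_self_eq_norm_sq, sum_inner]
    simp only [inner_sum, ite_and, ite_smul, one_smul, zero_smul, Finset.sum_ite_irrel,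
      Finset.sum_const_zero, Finset.sum_ite_mem, Finset.univ_inter]
  have h2 : ∀ i j, subsetAverage b
        (fun S : Finset (Fin n) => (if i ∈ S ∧ j ∈ S then (1 : ℝ) else 0) • inner ℝ (u i) (u j))
      = c * inner ℝ (u i) (u j) + if i = j then ((b : ℝ) / n - c) * ‖u j‖ ^ 2 else 0 := by
    intro i j
    rw [subsetAverage_smul_right]
    split_ifs with hij
    · subst hij
      simp only [and_self, subsetAverage_mem hb hbn, smul_eq_mul, real_inner_self_eq_norm_sq]
      ring
    · simp [hcp i j hij]
  have h3 : ∑ i, ∑ j, inner ℝ (u i) (u j) = (0 : ℝ) := by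
    simp_rw [← inner_sum, ← sum_inner, hu, inner_zero_left]
  rw [h1, subsetAverage_sum]
  simp_rw [subsetAverage_sum, h2, Finset.sum_add_distrib, ← Finset.mul_sum, h3]
  simp only [mul_zero, Finset.sum_ite_eq, Finset.mem_univ, if_true, zero_add, ← Finset.mul_sum]
  exact mul_le_mul_of_nonneg_right (by linarith) (Finset.sum_nonneg fun _ _ => by positivity)

theorem sum_norm_sub_mean_sq_le (hn : n ≠ 0) (u : Fin n → E) :
    ∑ j, ‖u j - (1 / (n : ℝ)) • ∑ i, u i‖ ^ 2 ≤ ∑ j, ‖u j‖ ^ 2 := by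
  set a := (1 / (n : ℝ)) • ∑ i, u i with ha
  have hn' : (n : ℝ) ≠ 0 := by exact_mod_cast hn
  have hs : ∑ i, u i = (n : ℝ) • a := by rw [ha, smul_smul]; field_simp; simp
  have h : ∑ j, inner ℝ (u j) a = n * ‖a‖ ^ 2 := by
    rw [← sum_inner, hs, real_inner_smul_left, real_inner_self_eq_norm_sq]
  simp_rw [norm_sub_sq_real, Finset.sum_add_distrib, Finset.sum_sub_distrib, ← Finset.mul_sum, h]
  simp
  have : 0 ≤ (n : ℝ) * ‖a‖ ^ 2 := by positivity
  linarith

/-- The second moment of a shifted, centred mini-batch mean. -/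
theorem subsetAverage_norm_batch_error_sq_le (hb : 1 ≤ b) (hbn : b ≤ n) (u : Fin n → E) (w : E) :
    subsetAverage b (fun S : Finset (Fin n) =>
        ‖(1 / (b : ℝ)) • ∑ j ∈ S, u j - (1 / (n : ℝ)) • ∑ j, u j + w‖ ^ 2)
      ≤ 1 / (b * n) * ∑ j, ‖u j‖ ^ 2 + ‖w‖ ^ 2 := by
  have hn : n ≠ 0 := by lia
  have hn' : (n : ℝ) ≠ 0 := by exact_mod_cast hn
  have hb' : (b : ℝ) ≠ 0 := by exact_mod_cast (by lia : b ≠ 0)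
  set a := (1 / (n : ℝ)) • ∑ i, u i with ha
  have hz : ∑ j, (u j - a) = 0 := by
    simp only [Finset.sum_sub_distrib, Finset.sum_const, Finset.card_univ, Fintype.card_fin,
      ← Nat.cast_smul_eq_nsmul ℝ, ha, smul_smul]
    field_simp
    simp
  have h1 : subsetAverage b (fun S : Finset (Fin n) => ‖(1 / (b : ℝ)) • ∑ j ∈ S, u j - a + w‖ ^ 2)
      = subsetAverage b (fun S => (1 / (b : ℝ)) ^ 2 • ‖∑ j ∈ S, (u j - a)‖ ^ 2
          + ((2 / (b : ℝ)) • inner ℝ w (∑ j ∈ S, (u j - a)) + ‖w‖ ^ 2)) := by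
    refine subsetAverage_congr fun S hS => ?_
    -- Subtracting the mean termwise is exact because `S` has exactly `b` elements.
    have : (1 / (b : ℝ)) • ∑ j ∈ S, u j - a = (1 / (b : ℝ)) • ∑ j ∈ S, (u j - a) := by
      simp only [Finset.sum_sub_distrib, Finset.sum_const, hS, ← Nat.cast_smul_eq_nsmul ℝ,
        smul_sub, smul_smul]
      field_simp
      simp
    rw [this, norm_add_sq_real, norm_smul, real_inner_smul_left, real_inner_comm]
    simp only [smul_eq_mul, mul_pow, Real.norm_eq_abs, sq_abs]
    ring
  -- The cross term averages to zero: the centred vectors sum to zero.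
  have h2 : subsetAverage b (fun S : Finset (Fin n) => (inner ℝ w (∑ j ∈ S, (u j - a)) : ℝ))
      = 0 := by
    simp_rw [inner_sum]
    rw [subsetAverage_sum_mem hb hbn, ← inner_sum, hz, inner_zero_right, smul_zero]
  rw [h1, subsetAverage_add, subsetAverage_add, subsetAverage_smul, subsetAverage_smul,
    subsetAverage_const hbn, h2, smul_zero, zero_add, smul_eq_mul]
  refine add_le_add ?_ le_rfl
  calc (1 / (b : ℝ)) ^ 2 * subsetAverage b (fun S : Finset (Fin n) => ‖∑ j ∈ S, (u j - a)‖ ^ 2)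
      ≤ (1 / (b : ℝ)) ^ 2 * ((b : ℝ) / n * ∑ j, ‖u j‖ ^ 2) := by
        gcongr
        refine (subsetAverage_norm_sum_sq_le hb hbn _ hz).trans ?_
        exact mul_le_mul_of_nonneg_left (sum_norm_sub_mean_sq_le hn u) (by positivity)
    _ = 1 / (b * n) * ∑ j, ‖u j‖ ^ 2 := by field_simp

end Variance

/-! ### Conditional expectation over an independent finite-valued batch. -/

section Sampling

variable {Ω : Type*} {m' mΩ : MeasurableSpace Ω} {μ : Measure Ω} {n : ℕ}
  {E : Type*} [NormedAddCommGroup E]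

theorem apply_eq_sum_indicator (K : Ω → Finset (Fin n)) (φ : Finset (Fin n) → Ω → E) :
    (fun ω => φ (K ω) ω) = fun ω => ∑ S, {ω | K ω = S}.indicator (φ S) ω := by
  ext ω
  simp [Set.indicator_apply]

theorem stronglyMeasurable_comp_finset {K : Ω → Finset (Fin n)}
    (hK : Measurable[m', (⊤ : MeasurableSpace (Finset (Fin n)))] K)
    {φ : Finset (Fin n) → Ω → E} (hφ : ∀ S, StronglyMeasurable[m'] (φ S)) :
    StronglyMeasurable[m'] (fun ω => φ (K ω) ω) := by
  rw [apply_eq_sum_indicator]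
  exact Finset.stronglyMeasurable_fun_sum _ fun S _ =>
    (hφ S).indicator (hK (t := {S}) trivial)

theorem memLp_comp_finset {K : Ω → Finset (Fin n)}
    (hK : Measurable[mΩ, (⊤ : MeasurableSpace (Finset (Fin n)))] K) {p : ENNReal}
    {φ : Finset (Fin n) → Ω → E} (hφ : ∀ S, MemLp (φ S) p μ) :
    MemLp (fun ω => φ (K ω) ω) p μ := by
  rw [apply_eq_sum_indicator]
  exact memLp_finsetSum _ fun S _ => (hφ S).indicator (hK (t := {S}) trivial)

variable [NormedSpace ℝ E] [CompleteSpace E]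

/-- Freezing: split over the finitely many values of `K`. On each piece the factor `φ S` is known
given `m'` and comes out, and the independent indicator contributes its probability. -/
theorem condExp_comp_finset [IsProbabilityMeasure μ] (hm : m' ≤ mΩ)
    {K : Ω → Finset (Fin n)}
    (hK : Measurable[mΩ, (⊤ : MeasurableSpace (Finset (Fin n)))] K)
    (hind : Indep (MeasurableSpace.comap K ⊤) m' μ)
    {φ : Finset (Fin n) → Ω → E} (hφ : ∀ S, StronglyMeasurable[m'] (φ S))
    (hint : ∀ S, Integrable (φ S) μ) :
    μ[fun ω => φ (K ω) ω | m'] =ᵐ[μ] fun ω => ∑ S, μ.real {ω | K ω = S} • φ S ω := by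
  have hset : ∀ S, MeasurableSet[mΩ] {ω | K ω = S} := fun S => hK (t := {S}) trivial
  have hterm : ∀ S, μ[{ω | K ω = S}.indicator (φ S) | m'] =ᵐ[μ]
      fun ω => μ.real {ω | K ω = S} • φ S ω := by
    intro S
    have h1 : {ω | K ω = S}.indicator (φ S)
        = ({ω | K ω = S}.indicator (fun _ => (1 : ℝ))) • φ S := by
      ext ω
      by_cases h : K ω = S <;> simp [h]
    have hi : Integrable ({ω | K ω = S}.indicator (fun _ => (1 : ℝ))) μ :=
      (integrable_const _).indicator (hset S)
    have h2 : μ[{ω | K ω = S}.indicator (fun _ => (1 : ℝ)) | m']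
        =ᵐ[μ] fun _ => μ.real {ω | K ω = S} := by
      have := condExp_indep_eq (m₁ := MeasurableSpace.comap K ⊤) (m₂ := m') (μ := μ)
        (f := {ω | K ω = S}.indicator (fun _ => (1 : ℝ))) (hK.comap_le) hm
        (stronglyMeasurable_const.indicator ⟨{S}, trivial, rfl⟩) hind
      rwa [integral_indicator_const _ (hset S), smul_eq_mul, mul_one] at this
    rw [h1]
    refine (condExp_smul_of_aestronglyMeasurable_right hi
      (h1 ▸ (hint S).indicator (hset S)) (hφ S).aestronglyMeasurable).trans ?_
    filter_upwards [h2] with ω hω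
    simp [hω]
  rw [apply_eq_sum_indicator]
  have hfun : (fun ω => ∑ S, {ω | K ω = S}.indicator (φ S) ω)
      = ∑ S, {ω | K ω = S}.indicator (φ S) := by
    ext ω; simp
  rw [hfun]
  refine (condExp_finsetSum (fun S _ => (hint S).indicator (hset S)) m').trans ?_
  filter_upwards [ae_all_iff.2 hterm] with ω hω
  simp [hω]

end Sampling

namespace IsMinibatchSampling

variable {Ω : Type*} [mΩ : MeasurableSpace Ω] {μ : Measure Ω} {ℱ : Filtration ℕ mΩ} {n b : ℕ}
  {J : ℕ → Ω → Finset (Fin n)} {E : Type*} [NormedAddCommGroup E]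

theorem measurable (hJ : IsMinibatchSampling μ ℱ b J) (k : ℕ) :
    Measurable[mΩ, (⊤ : MeasurableSpace (Finset (Fin n)))] (J k) :=
  (hJ.measurable_next k).mono (ℱ.le _) le_rfl

variable [NormedSpace ℝ E]

theorem sum_real_smul (hJ : IsMinibatchSampling μ ℱ b J) (k : ℕ) (φ : Finset (Fin n) → E) :
    ∑ S, μ.real {ω | J k ω = S} • φ S = subsetAverage b φ := by
  rw [subsetAverage, Finset.smul_sum,
    ← Finset.sum_subset (Finset.subset_univ (Finset.powersetCard b Finset.univ))]
  · refine Finset.sum_congr rfl fun S hS => ?_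
    rw [hJ.uniform k S (Finset.mem_powersetCard_univ.1 hS), one_div]
  · intro S _ hS
    have : μ {ω | J k ω = S} = 0 := by
      refine measure_mono_null (fun ω hω => ?_) (ae_iff.1 (hJ.card_eq k))
      rw [Finset.mem_powersetCard_univ] at hS
      rw [Set.mem_ofPred_eq] at hω ⊢
      rwa [hω]
    simp [Measure.real, this]

variable [CompleteSpace E] [IsProbabilityMeasure μ]

theorem condExp_eq (hJ : IsMinibatchSampling μ ℱ b J) (k : ℕ) {φ : Finset (Fin n) → Ω → E}
    (hφ : ∀ S, StronglyMeasurable[ℱ k] (φ S)) (hint : ∀ S, Integrable (φ S) μ) :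
    μ[fun ω => φ (J k ω) ω | ℱ k] =ᵐ[μ] fun ω => subsetAverage b (fun S => φ S ω) := by
  refine (condExp_comp_finset (ℱ.le k) (hJ.measurable k) (hJ.indep_past k) hφ hint).trans ?_
  exact Filter.Eventually.of_forall fun ω => hJ.sum_real_smul k fun S => φ S ω

theorem integral_eq (hJ : IsMinibatchSampling μ ℱ b J) (k : ℕ) {φ : Finset (Fin n) → Ω → E}
    (hφ : ∀ S, StronglyMeasurable[ℱ k] (φ S)) (hint : ∀ S, Integrable (φ S) μ) :
    ∫ ω, φ (J k ω) ω ∂μ = ∫ ω, subsetAverage b (fun S => φ S ω) ∂μ := by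
  rw [← integral_condExp (ℱ.le k), integral_congr_ae (hJ.condExp_eq k hφ hint)]

end IsMinibatchSampling

/-- All the second-moment recursions pass through this reduction: it suffices to bound the subset
average pointwise, with the history frozen. -/
theorem IsMinibatchSampling.integral_norm_sq_le {Ω : Type*} [mΩ : MeasurableSpace Ω]
    {μ : Measure Ω} [IsProbabilityMeasure μ] {ℱ : Filtration ℕ mΩ} {n b : ℕ}
    {J : ℕ → Ω → Finset (Fin n)} {E : Type*} [NormedAddCommGroup E]
    (hJ : IsMinibatchSampling μ ℱ b J) (k : ℕ) {φ : Finset (Fin n) → Ω → E}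
    (hφ : ∀ S, StronglyMeasurable[ℱ k] (φ S)) (hφ2 : ∀ S, MemLp (φ S) 2 μ)
    {ψ : Ω → ℝ} (hψ : Integrable ψ μ)
    (h : ∀ ω, subsetAverage b (fun S => ‖φ S ω‖ ^ 2) ≤ ψ ω) :
    ∫ ω, ‖φ (J k ω) ω‖ ^ 2 ∂μ ≤ ∫ ω, ψ ω ∂μ := by
  have hint : ∀ S, Integrable (fun ω => ‖φ S ω‖ ^ 2) μ := fun S =>
    (hφ2 S).integrable_norm_pow two_ne_zero
  rw [hJ.integral_eq k (φ := fun S ω => ‖φ S ω‖ ^ 2) (fun S => (hφ S).norm.pow 2) hint]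
  have havg : Integrable (fun ω => subsetAverage b (fun S => ‖φ S ω‖ ^ 2)) μ :=
    (integrable_finsetSum (Finset.powersetCard b Finset.univ) fun S _ => hint S).const_mul
      (n.choose b : ℝ)⁻¹
  exact integral_mono havg hψ h

/-! ### Scalar recursions and their discounted sums. -/

/-- The geometrically discounted sum `∑_{l < k} r ^ (k - 1 - l) * δ l`. -/
def discountedSum (r : ℝ) (δ : ℕ → ℝ) : ℕ → ℝ
  | 0 => 0
  | k + 1 => δ k + r * discountedSum r δ k

theorem discountedSum_nonneg {r : ℝ} (hr : 0 ≤ r) {δ : ℕ → ℝ} (hδ : ∀ k, 0 ≤ δ k) (k : ℕ) :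
    0 ≤ discountedSum r δ k := by
  induction k with
  | zero => exact le_rfl
  | succ k ih => exact add_nonneg (hδ k) (mul_nonneg hr ih)

theorem le_mul_discountedSum {r c : ℝ} (hr : 0 ≤ r) {δ u : ℕ → ℝ} (h0 : u 0 ≤ 0)
    (hu : ∀ k, u (k + 1) ≤ c * δ k + r * u k) (k : ℕ) : u k ≤ c * discountedSum r δ k := by
  induction k with
  | zero => simpa [discountedSum] using h0
  | succ k ih =>
    calc u (k + 1) ≤ c * δ k + r * u k := hu k
      _ ≤ c * δ k + r * (c * discountedSum r δ k) := by gcongr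
      _ = c * discountedSum r δ (k + 1) := by rw [discountedSum]; ring

/-- The coupled recursions for the mean square errors `v` of SARGE, with `p` the inclusion
probability, `H` and `R` the mean squares of the stored differences and of the age of the table. -/
theorem error_le_discountedSum {p B : ℝ} (hp : 0 < p) (hp3 : p ≤ 1 / 3) (hB : 1 ≤ B)
    {δ v H R : ℕ → ℝ} (hδ : ∀ k, 0 ≤ δ k) (hv0 : v 0 ≤ 0) (hH0 : H 0 ≤ 0) (hR0 : R 0 ≤ 0)
    (hH : ∀ k, H (k + 1) ≤ p * δ k + (1 - p) * H k) (hHn : ∀ k, 0 ≤ H k)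
    (hR : ∀ k, R (k + 1) ≤ 2 / p * δ k + (1 - p / 2) * R k)
    (hv : ∀ k, v (k + 1) ≤ 1 / B * (3 * (δ k + H k + p ^ 2 * R k)) + (1 - p) ^ 2 * v k) (k : ℕ) :
    v k ≤ 12 * discountedSum (1 - p / 2) δ k := by
  have hr : 0 ≤ 1 - p / 2 := by linarith
  -- `H` contracts at the faster rate `1 - p`; relaxing it to `1 - p/2` lets one discounted sum
  -- dominate both `H` and `R`.
  have hH' : ∀ k, H k ≤ p * discountedSum (1 - p / 2) δ k :=
    le_mul_discountedSum hr hH0 fun k => (hH k).trans (by nlinarith [hHn k])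
  have hR' : ∀ k, R k ≤ 2 / p * discountedSum (1 - p / 2) δ k :=
    le_mul_discountedSum hr hR0 hR
  induction k with
  | zero => simpa [discountedSum] using hv0
  | succ k ih =>
    set s := discountedSum (1 - p / 2) δ k with hs
    have hsn : 0 ≤ s := discountedSum_nonneg hr hδ k
    have h1 : p ^ 2 * R k ≤ 2 * p * s := by
      calc p ^ 2 * R k ≤ p ^ 2 * (2 / p * s) := by gcongr; exact hR' k
        _ = 2 * p * s := by field_simp
    have h2 : 1 / B * (3 * (δ k + H k + p ^ 2 * R k)) ≤ 3 * (δ k + 3 * p * s) := by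
      -- The variance reduction `1/B` is simply given up.
      have hB1 : 1 / B ≤ 1 := by rw [div_le_one (by linarith)]; exact hB
      have h3 : 3 * (δ k + H k + p ^ 2 * R k) ≤ 3 * (δ k + 3 * p * s) := by
        linarith [hH' k]
      have h4 : 0 ≤ 3 * (δ k + 3 * p * s) := by
        have := hδ k
        positivity
      calc 1 / B * (3 * (δ k + H k + p ^ 2 * R k)) ≤ 1 / B * (3 * (δ k + 3 * p * s)) := by
            gcongr
        _ ≤ _ := mul_le_of_le_one_left h4 hB1
    have h5 : (1 - p) ^ 2 * v k ≤ (1 - p) ^ 2 * (12 * s) := by gcongr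
    -- This is the slack in `9 p s + 12 (1 - p)² s ≤ 12 (1 - p/2) s`; it is nonnegative as soon as
    -- `p ≤ 3/4`.
    have h6 : 0 ≤ p * s * (9 - 12 * p) := by
      have : 0 ≤ 9 - 12 * p := by linarith
      positivity
    rw [discountedSum, ← hs]
    nlinarith [hv k, hδ k]

/-! ### Elementary norm inequalities. -/

section Norm

variable {E : Type*} [SeminormedAddCommGroup E]

theorem norm_add_sq_le_weighted {c : ℝ} (hc : 0 < c) (u v : E) :
    ‖u + v‖ ^ 2 ≤ (1 + 1 / c) * ‖u‖ ^ 2 + (1 + c) * ‖v‖ ^ 2 := by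
  have h1 := norm_add_le u v
  have h2 : ‖u + v‖ ^ 2 ≤ (‖u‖ + ‖v‖) ^ 2 := by gcongr
  have h3 : 0 ≤ 1 / c * (‖u‖ - c * ‖v‖) ^ 2 := by positivity
  have h4 : 1 / c * (‖u‖ - c * ‖v‖) ^ 2 = 1 / c * ‖u‖ ^ 2 - 2 * ‖u‖ * ‖v‖ + c * ‖v‖ ^ 2 := by
    field_simp
    ring
  nlinarith

theorem norm_sub_add_sq_le (u v w : E) :
    ‖u - v + w‖ ^ 2 ≤ 3 * (‖u‖ ^ 2 + ‖v‖ ^ 2 + ‖w‖ ^ 2) := by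
  have h1 : ‖u - v + w‖ ≤ ‖u‖ + ‖v‖ + ‖w‖ :=
    (norm_add_le _ _).trans (by gcongr; exact norm_sub_le _ _)
  have h2 : ‖u - v + w‖ ^ 2 ≤ (‖u‖ + ‖v‖ + ‖w‖) ^ 2 := by gcongr
  nlinarith [sq_nonneg (‖u‖ - ‖v‖), sq_nonneg (‖u‖ - ‖w‖), sq_nonneg (‖v‖ - ‖w‖)]

/-- Here `u` is the newest gradient difference and `v` the old age. Young's inequality with weight
`p/2` works because `(1 - p)(1 + p/2) = 1 - p/2 - p²/2`, at the price of the `2/p` on `‖u‖²`. -/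
theorem norm_age_sq_le {p : ℝ} (hp : 0 < p) (hp1 : p ≤ 1) (u v : E) :
    p * ‖u‖ ^ 2 + (1 - p) * ‖u + v‖ ^ 2 ≤ 2 / p * ‖u‖ ^ 2 + (1 - p / 2) * ‖v‖ ^ 2 := by
  have h1 := norm_add_sq_le_weighted (half_pos hp) u v
  have h2 := mul_le_mul_of_nonneg_left h1 (sub_nonneg.2 hp1)
  have h3 : (1 - p) * (1 + 1 / (p / 2)) = 2 / p - 1 - p := by field_simp; ring
  have h4 : 0 ≤ p ^ 2 * ‖v‖ ^ 2 := by positivity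
  nlinarith [sq_nonneg ‖u‖]

end Norm

/-! ### SARGE along a single realization: algebraic identities. -/

theorem gradient_finiteSum {n m : ℕ} {f : Fin n → EuclideanSpace ℝ (Fin m) → ℝ}
    (hf : ∀ i, Differentiable ℝ (f i)) (y : EuclideanSpace ℝ (Fin m)) :
    gradient (finiteSum f) y = (1 / (n : ℝ)) • ∑ i, gradient (f i) y := by
  have h : HasFDerivAt (finiteSum f) ((1 / (n : ℝ)) • ∑ i, fderiv ℝ (f i) y) y :=
    (HasFDerivAt.fun_sum fun i _ => (hf i y).hasFDerivAt).const_mul _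
  simp only [gradient, h.fderiv, map_smul, map_sum]

/-- The gradients stored by SARGE: `∇f_i` at the point that was current when `i` was last drawn,
and `∇f_i(x₀)` before that. -/
noncomputable def sargeMemory {n m : ℕ} (f : Fin n → EuclideanSpace ℝ (Fin m) → ℝ)
    (x : ℕ → EuclideanSpace ℝ (Fin m)) (J : ℕ → Finset (Fin n)) :
    ℕ → Fin n → EuclideanSpace ℝ (Fin m)
  | 0, i => gradient (f i) (x 0)
  | k + 1, i => if i ∈ J k then gradient (f i) (x k) else sargeMemory f x J k i

/-- The vector `∇f_i(x_{k+1}) - (1 - b/n) ∇f_i(x_k) - ψ_k^i` that SARGE samples. -/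
noncomputable def sargeInnovation {n m : ℕ} (f : Fin n → EuclideanSpace ℝ (Fin m) → ℝ) (b : ℕ)
    (x : ℕ → EuclideanSpace ℝ (Fin m)) (J : ℕ → Finset (Fin n)) (k : ℕ) (i : Fin n) :
    EuclideanSpace ℝ (Fin m) :=
  gradient (f i) (x (k + 1)) - (1 - (b : ℝ) / n) • gradient (f i) (x k) - sargeTable f b x J k i

section Pathwise

variable {n m b : ℕ} {f : Fin n → EuclideanSpace ℝ (Fin m) → ℝ}
  {x : ℕ → EuclideanSpace ℝ (Fin m)} {J : ℕ → Finset (Fin n)}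

theorem sargeTable_sub_memory_zero (i : Fin n) :
    sargeTable f b x J 0 i - ((b : ℝ) / n) • sargeMemory f x J 0 i = 0 := by
  simp only [sargeTable, sargeMemory]
  module

/-- Removing `b/n` times the memory turns the stored combination into a pure one-step gradient
difference, kept until `i` is drawn again. -/
theorem sargeTable_sub_memory_succ (k : ℕ) (i : Fin n) :
    sargeTable f b x J (k + 1) i - ((b : ℝ) / n) • sargeMemory f x J (k + 1) i
      = if i ∈ J k then gradient (f i) (x (k + 1)) - gradient (f i) (x k)
        else sargeTable f b x J k i - ((b : ℝ) / n) • sargeMemory f x J k i := by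
  simp only [sargeTable, sargeMemory]
  split_ifs
  · module
  · rfl

theorem gradient_sub_memory_succ (k : ℕ) (i : Fin n) :
    gradient (f i) (x (k + 1)) - sargeMemory f x J (k + 1) i
      = (gradient (f i) (x (k + 1)) - gradient (f i) (x k))
        + if i ∈ J k then 0 else gradient (f i) (x k) - sargeMemory f x J k i := by
  simp only [sargeMemory]
  split_ifs <;> module

theorem norm_sargeInnovation_sq_le (k : ℕ) (i : Fin n) :
    ‖sargeInnovation f b x J k i‖ ^ 2
      ≤ 3 * (‖gradient (f i) (x (k + 1)) - gradient (f i) (x k)‖ ^ 2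
        + ‖sargeTable f b x J k i - ((b : ℝ) / n) • sargeMemory f x J k i‖ ^ 2
        + ((b : ℝ) / n) ^ 2 * ‖gradient (f i) (x k) - sargeMemory f x J k i‖ ^ 2) := by
  have h : sargeInnovation f b x J k i
      = (gradient (f i) (x (k + 1)) - gradient (f i) (x k))
        - (sargeTable f b x J k i - ((b : ℝ) / n) • sargeMemory f x J k i)
        + ((b : ℝ) / n) • (gradient (f i) (x k) - sargeMemory f x J k i) := by
    unfold sargeInnovation
    module
  rw [h]
  refine (norm_sub_add_sq_le _ _ _).trans_eq ?_
  rw [norm_smul, mul_pow, Real.norm_eq_abs, sq_abs]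

/-- One step of SARGE with mini-batch `S`. -/
theorem sarge_succ_eq (k : ℕ) :
    sarge f b x J (k + 1) = (1 / (n : ℝ)) • ∑ i, gradient (f i) (x (k + 1))
      + ((1 / (b : ℝ)) • ∑ j ∈ J k, sargeInnovation f b x J k j
        - (1 / (n : ℝ)) • ∑ j, sargeInnovation f b x J k j
        + (1 - (b : ℝ) / n) • (sarge f b x J k - (1 / (n : ℝ)) • ∑ i, gradient (f i) (x k))) := by
  simp only [sarge, sargeInnovation, Finset.sum_sub_distrib, ← Finset.smul_sum]
  module

end Pathwise

section StepError

variable {Ω : Type*} {n m b : ℕ} {f : Fin n → EuclideanSpace ℝ (Fin m) → ℝ}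
  {J : ℕ → Ω → Finset (Fin n)} {x : ℕ → Ω → EuclideanSpace ℝ (Fin m)}

/-- The error of one step of SARGE when the mini-batch is `S`. -/
noncomputable def sargeStepError (f : Fin n → EuclideanSpace ℝ (Fin m) → ℝ) (b : ℕ)
    (x : ℕ → Ω → EuclideanSpace ℝ (Fin m)) (J : ℕ → Ω → Finset (Fin n)) (k : ℕ)
    (S : Finset (Fin n)) (ω : Ω) : EuclideanSpace ℝ (Fin m) :=
  (1 / (b : ℝ)) • ∑ j ∈ S, sargeInnovation f b (fun l => x l ω) (fun l => J l ω) k j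
    - (1 / (n : ℝ)) • ∑ j, sargeInnovation f b (fun l => x l ω) (fun l => J l ω) k j
    + (1 - (b : ℝ) / n) • (sarge f b (fun l => x l ω) (fun l => J l ω) k
      - (1 / (n : ℝ)) • ∑ i, gradient (f i) (x k ω))

/-- With the batch left as a free argument, the step error depends only on the past and on
`x_{k+1}`; all fresh randomness enters by substituting `J_k`. -/
theorem sarge_succ_eq_stepError (k : ℕ) (ω : Ω) :
    sarge f b (fun l => x l ω) (fun l => J l ω) (k + 1)
      = (1 / (n : ℝ)) • ∑ i, gradient (f i) (x (k + 1) ω) + sargeStepError f b x J k (J k ω) ω :=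
  sarge_succ_eq k

theorem stronglyMeasurable_mean_gradient {m' : MeasurableSpace Ω} {k : ℕ}
    (hG : ∀ i, StronglyMeasurable[m'] fun ω => gradient (f i) (x k ω)) :
    StronglyMeasurable[m'] fun ω => (1 / (n : ℝ)) • ∑ i, gradient (f i) (x k ω) :=
  (Finset.stronglyMeasurable_fun_sum _ fun i _ => hG i).fun_const_smul _

end StepError

/-! ### Measurability and square integrability of the SARGE quantities. -/

section MemLp

variable {Ω : Type*} {mΩ : MeasurableSpace Ω} {μ : Measure Ω} {p : ENNReal} {E : Type*}
  [NormedAddCommGroup E] {u v : Ω → E}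

theorem MeasureTheory.MemLp.fun_add (hu : MemLp u p μ) (hv : MemLp v p μ) :
    MemLp (fun ω => u ω + v ω) p μ := hu.add hv

theorem MeasureTheory.MemLp.fun_sub (hu : MemLp u p μ) (hv : MemLp v p μ) :
    MemLp (fun ω => u ω - v ω) p μ := hu.sub hv

theorem MeasureTheory.MemLp.fun_const_smul [NormedSpace ℝ E] (hu : MemLp u p μ) (c : ℝ) :
    MemLp (fun ω => c • u ω) p μ := hu.const_smul c

end MemLp

section Regularity

variable {Ω : Type*} [mΩ : MeasurableSpace Ω] {μ : Measure Ω} {ℱ : Filtration ℕ mΩ}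
  {n m b : ℕ} {f : Fin n → EuclideanSpace ℝ (Fin m) → ℝ} {J : ℕ → Ω → Finset (Fin n)}
  {x : ℕ → Ω → EuclideanSpace ℝ (Fin m)}

theorem stronglyMeasurable_sargeTable
    (hJ : IsMinibatchSampling μ ℱ b J)
    (hG : ∀ i k, StronglyMeasurable[ℱ k] fun ω => gradient (f i) (x k ω))
    (hG' : ∀ i k, StronglyMeasurable[ℱ k] fun ω => gradient (f i) (x (k + 1) ω))
    (k : ℕ) (i : Fin n) :
    StronglyMeasurable[ℱ k] fun ω => sargeTable f b (fun l => x l ω) (fun l => J l ω) k i := by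
  induction k with
  | zero => exact (hG i 0).fun_sub ((hG i 0).fun_const_smul _)
  | succ k ih =>
    refine stronglyMeasurable_comp_finset (hJ.measurable_next k) (φ := fun S ω => if i ∈ S
      then gradient (f i) (x (k + 1) ω) - (1 - (b : ℝ) / n) • gradient (f i) (x k ω)
      else sargeTable f b (fun l => x l ω) (fun l => J l ω) k i) fun S => ?_
    split_ifs
    · exact ((hG' i k).fun_sub ((hG i k).fun_const_smul _)).mono (ℱ.mono k.le_succ)
    · exact ih.mono (ℱ.mono k.le_succ)

theorem memLp_sargeTable (hJ : IsMinibatchSampling μ ℱ b J)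
    (hx2 : ∀ i k, MemLp (fun ω => gradient (f i) (x k ω)) 2 μ) (k : ℕ) (i : Fin n) :
    MemLp (fun ω => sargeTable f b (fun l => x l ω) (fun l => J l ω) k i) 2 μ := by
  induction k with
  | zero => exact (hx2 i 0).fun_sub ((hx2 i 0).fun_const_smul _)
  | succ k ih =>
    refine memLp_comp_finset (hJ.measurable k) (φ := fun S ω => if i ∈ S
      then gradient (f i) (x (k + 1) ω) - (1 - (b : ℝ) / n) • gradient (f i) (x k ω)
      else sargeTable f b (fun l => x l ω) (fun l => J l ω) k i) fun S => ?_
    split_ifs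
    · exact (hx2 i (k + 1)).fun_sub ((hx2 i k).fun_const_smul _)
    · exact ih

theorem stronglyMeasurable_sargeMemory
    (hJ : IsMinibatchSampling μ ℱ b J)
    (hG : ∀ i k, StronglyMeasurable[ℱ k] fun ω => gradient (f i) (x k ω))
    (k : ℕ) (i : Fin n) :
    StronglyMeasurable[ℱ k] fun ω => sargeMemory f (fun l => x l ω) (fun l => J l ω) k i := by
  induction k with
  | zero => exact hG i 0
  | succ k ih =>
    refine stronglyMeasurable_comp_finset (hJ.measurable_next k) (φ := fun S ω => if i ∈ S
      then gradient (f i) (x k ω)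
      else sargeMemory f (fun l => x l ω) (fun l => J l ω) k i) fun S => ?_
    split_ifs
    · exact (hG i k).mono (ℱ.mono k.le_succ)
    · exact ih.mono (ℱ.mono k.le_succ)

theorem memLp_sargeMemory (hJ : IsMinibatchSampling μ ℱ b J)
    (hx2 : ∀ i k, MemLp (fun ω => gradient (f i) (x k ω)) 2 μ) (k : ℕ) (i : Fin n) :
    MemLp (fun ω => sargeMemory f (fun l => x l ω) (fun l => J l ω) k i) 2 μ := by
  induction k with
  | zero => exact hx2 i 0
  | succ k ih =>
    refine memLp_comp_finset (hJ.measurable k) (φ := fun S ω => if i ∈ S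
      then gradient (f i) (x k ω)
      else sargeMemory f (fun l => x l ω) (fun l => J l ω) k i) fun S => ?_
    split_ifs
    · exact hx2 i k
    · exact ih

theorem stronglyMeasurable_sargeInnovation
    (hJ : IsMinibatchSampling μ ℱ b J)
    (hG : ∀ i k, StronglyMeasurable[ℱ k] fun ω => gradient (f i) (x k ω))
    (hG' : ∀ i k, StronglyMeasurable[ℱ k] fun ω => gradient (f i) (x (k + 1) ω))
    (k : ℕ) (i : Fin n) :
    StronglyMeasurable[ℱ k]
      fun ω => sargeInnovation f b (fun l => x l ω) (fun l => J l ω) k i :=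
  ((hG' i k).fun_sub ((hG i k).fun_const_smul _)).fun_sub (stronglyMeasurable_sargeTable hJ hG hG' k i)

theorem memLp_sargeInnovation (hJ : IsMinibatchSampling μ ℱ b J)
    (hx2 : ∀ i k, MemLp (fun ω => gradient (f i) (x k ω)) 2 μ) (k : ℕ) (i : Fin n) :
    MemLp (fun ω => sargeInnovation f b (fun l => x l ω) (fun l => J l ω) k i) 2 μ :=
  ((hx2 i (k + 1)).fun_sub ((hx2 i k).fun_const_smul _)).fun_sub (memLp_sargeTable hJ hx2 k i)

theorem memLp_mean_gradient (hx2 : ∀ i k, MemLp (fun ω => gradient (f i) (x k ω)) 2 μ) (k : ℕ) :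
    MemLp (fun ω => (1 / (n : ℝ)) • ∑ i, gradient (f i) (x k ω)) 2 μ :=
  (memLp_finsetSum _ fun i _ => hx2 i k).fun_const_smul _

theorem memLp_sargeStepError (hJ : IsMinibatchSampling μ ℱ b J)
    (hx2 : ∀ i k, MemLp (fun ω => gradient (f i) (x k ω)) 2 μ) {k : ℕ}
    (hg : MemLp (fun ω => sarge f b (fun l => x l ω) (fun l => J l ω) k) 2 μ)
    (S : Finset (Fin n)) : MemLp (sargeStepError f b x J k S) 2 μ :=
  (((memLp_finsetSum S fun j _ => memLp_sargeInnovation hJ hx2 k j).fun_const_smul _).fun_sub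
    ((memLp_finsetSum Finset.univ fun j _ => memLp_sargeInnovation hJ hx2 k j).fun_const_smul _)).fun_add
    ((hg.fun_sub (memLp_mean_gradient hx2 k)).fun_const_smul _)

theorem memLp_sarge (hdiff : ∀ i, Differentiable ℝ (f i)) (hJ : IsMinibatchSampling μ ℱ b J)
    (hx2 : ∀ i k, MemLp (fun ω => gradient (f i) (x k ω)) 2 μ) (k : ℕ) :
    MemLp (fun ω => sarge f b (fun l => x l ω) (fun l => J l ω) k) 2 μ := by
  induction k with
  | zero => simpa only [sarge, gradient_finiteSum hdiff] using memLp_mean_gradient hx2 0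
  | succ k ih =>
    simp_rw [sarge_succ_eq_stepError]
    exact (memLp_mean_gradient hx2 (k + 1)).fun_add
      (memLp_comp_finset (hJ.measurable k) (memLp_sargeStepError hJ hx2 ih))

theorem stronglyMeasurable_sargeStepError (hJ : IsMinibatchSampling μ ℱ b J)
    (hG : ∀ i k, StronglyMeasurable[ℱ k] fun ω => gradient (f i) (x k ω))
    (hG' : ∀ i k, StronglyMeasurable[ℱ k] fun ω => gradient (f i) (x (k + 1) ω)) {k : ℕ}
    (hg : StronglyMeasurable[ℱ k] fun ω => sarge f b (fun l => x l ω) (fun l => J l ω) k)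
    (S : Finset (Fin n)) : StronglyMeasurable[ℱ k] (sargeStepError f b x J k S) :=
  (((Finset.stronglyMeasurable_fun_sum S fun j _ =>
      stronglyMeasurable_sargeInnovation hJ hG hG' k j).fun_const_smul _).fun_sub
    ((Finset.stronglyMeasurable_fun_sum Finset.univ fun j _ =>
      stronglyMeasurable_sargeInnovation hJ hG hG' k j).fun_const_smul _)).fun_add
    ((hg.fun_sub (stronglyMeasurable_mean_gradient fun i => hG i k)).fun_const_smul _)

theorem stronglyMeasurable_sarge (hdiff : ∀ i, Differentiable ℝ (f i))
    (hJ : IsMinibatchSampling μ ℱ b J)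
    (hG : ∀ i k, StronglyMeasurable[ℱ k] fun ω => gradient (f i) (x k ω))
    (hG' : ∀ i k, StronglyMeasurable[ℱ k] fun ω => gradient (f i) (x (k + 1) ω)) (k : ℕ) :
    StronglyMeasurable[ℱ k] fun ω => sarge f b (fun l => x l ω) (fun l => J l ω) k := by
  induction k with
  | zero =>
    simpa only [sarge, gradient_finiteSum hdiff] using
      stronglyMeasurable_mean_gradient fun i => hG i 0
  | succ k ih =>
    simp_rw [sarge_succ_eq_stepError]
    exact (stronglyMeasurable_mean_gradient fun i => hG i (k + 1)).fun_add
      (stronglyMeasurable_comp_finset (hJ.measurable_next k) fun S =>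
        (stronglyMeasurable_sargeStepError hJ hG hG' ih S).mono (ℱ.mono k.le_succ))

end Regularity

theorem meanSqGradDiff_nonneg {Ω : Type*} [MeasurableSpace Ω] {μ : Measure Ω} {n m : ℕ}
    {f : Fin n → EuclideanSpace ℝ (Fin m) → ℝ} {x : ℕ → Ω → EuclideanSpace ℝ (Fin m)} (k : ℕ) :
    0 ≤ meanSqGradDiff μ f x k :=
  mul_nonneg (by positivity) (Finset.sum_nonneg fun _ _ => integral_nonneg fun _ => by positivity)

/-! ### One-step mean square bounds and the conditional mean. -/

section Moments

variable {Ω : Type*} [mΩ : MeasurableSpace Ω] {μ : Measure Ω} [IsProbabilityMeasure μ]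
  {ℱ : Filtration ℕ mΩ} {n m b : ℕ} {f : Fin n → EuclideanSpace ℝ (Fin m) → ℝ}
  {J : ℕ → Ω → Finset (Fin n)} {x : ℕ → Ω → EuclideanSpace ℝ (Fin m)}

/-- If `i` is drawn, the age resets to the newest gradient difference; otherwise that difference is
added to it. Averaging the two cases is the setting of `norm_age_sq_le`. -/
theorem integral_age_sq_succ_le (hb : 1 ≤ b) (hbn : b ≤ n) (hJ : IsMinibatchSampling μ ℱ b J)
    (hG : ∀ i k, StronglyMeasurable[ℱ k] fun ω => gradient (f i) (x k ω))
    (hG' : ∀ i k, StronglyMeasurable[ℱ k] fun ω => gradient (f i) (x (k + 1) ω))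
    (hx2 : ∀ i k, MemLp (fun ω => gradient (f i) (x k ω)) 2 μ) (k : ℕ) (i : Fin n) :
    ∫ ω, ‖gradient (f i) (x (k + 1) ω)
        - sargeMemory f (fun l => x l ω) (fun l => J l ω) (k + 1) i‖ ^ 2 ∂μ
      ≤ 2 / ((b : ℝ) / n) * ∫ ω, ‖gradient (f i) (x (k + 1) ω) - gradient (f i) (x k ω)‖ ^ 2 ∂μ
        + (1 - (b : ℝ) / n / 2) * ∫ ω, ‖gradient (f i) (x k ω)
          - sargeMemory f (fun l => x l ω) (fun l => J l ω) k i‖ ^ 2 ∂μ := by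
  have hn : (0 : ℝ) < n := by exact_mod_cast (by lia : 0 < n)
  have hb0 : (0 : ℝ) < b := by exact_mod_cast hb
  have hp1 : (b : ℝ) / n ≤ 1 := by rw [div_le_one hn]; exact_mod_cast hbn
  have hd := (hx2 i (k + 1)).fun_sub (hx2 i k)
  have hr := (hx2 i k).fun_sub (memLp_sargeMemory hJ hx2 k i)
  have hid := (hd.integrable_norm_pow two_ne_zero).const_mul (2 / ((b : ℝ) / n))
  have hir := (hr.integrable_norm_pow two_ne_zero).const_mul (1 - (b : ℝ) / n / 2)
  rw [← integral_const_mul, ← integral_const_mul, ← integral_add hid hir]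
  have hsucc : ∀ ω, gradient (f i) (x (k + 1) ω)
        - sargeMemory f (fun l => x l ω) (fun l => J l ω) (k + 1) i
      = (gradient (f i) (x (k + 1) ω) - gradient (f i) (x k ω)) + if i ∈ J k ω then 0
        else gradient (f i) (x k ω) - sargeMemory f (fun l => x l ω) (fun l => J l ω) k i :=
    fun ω =>
      gradient_sub_memory_succ (f := f) (x := fun l => x l ω) (J := fun l => J l ω) k i
  simp_rw [hsucc]
  refine hJ.integral_norm_sq_le k (φ := fun S ω =>
    (gradient (f i) (x (k + 1) ω) - gradient (f i) (x k ω)) + if i ∈ S then 0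
      else gradient (f i) (x k ω) - sargeMemory f (fun l => x l ω) (fun l => J l ω) k i)
    (fun S => ?_) (fun S => ?_) (hid.add hir) fun ω => ?_
  · refine ((hG' i k).fun_sub (hG i k)).fun_add ?_
    split_ifs
    · exact stronglyMeasurable_const
    · exact (hG i k).fun_sub (stronglyMeasurable_sargeMemory hJ hG k i)
  · refine hd.fun_add ?_
    split_ifs
    · exact memLp_const 0
    · exact hr
  · simp only [add_ite, add_zero, apply_ite norm, ite_pow]
    rw [subsetAverage_ite_mem hb hbn]
    exact norm_age_sq_le (by positivity) hp1 _ _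

theorem integral_storedDiff_sq_succ_le (hb : 1 ≤ b) (hbn : b ≤ n)
    (hJ : IsMinibatchSampling μ ℱ b J)
    (hG : ∀ i k, StronglyMeasurable[ℱ k] fun ω => gradient (f i) (x k ω))
    (hG' : ∀ i k, StronglyMeasurable[ℱ k] fun ω => gradient (f i) (x (k + 1) ω))
    (hx2 : ∀ i k, MemLp (fun ω => gradient (f i) (x k ω)) 2 μ) (k : ℕ) (i : Fin n) :
    ∫ ω, ‖sargeTable f b (fun l => x l ω) (fun l => J l ω) (k + 1) i
        - ((b : ℝ) / n) • sargeMemory f (fun l => x l ω) (fun l => J l ω) (k + 1) i‖ ^ 2 ∂μ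
      ≤ (b : ℝ) / n * ∫ ω, ‖gradient (f i) (x (k + 1) ω) - gradient (f i) (x k ω)‖ ^ 2 ∂μ
        + (1 - (b : ℝ) / n) * ∫ ω, ‖sargeTable f b (fun l => x l ω) (fun l => J l ω) k i
          - ((b : ℝ) / n) • sargeMemory f (fun l => x l ω) (fun l => J l ω) k i‖ ^ 2 ∂μ := by
  have hd := (hx2 i (k + 1)).fun_sub (hx2 i k)
  have hh := (memLp_sargeTable hJ hx2 k i).fun_sub
    ((memLp_sargeMemory hJ hx2 k i).fun_const_smul ((b : ℝ) / n))
  have hid := (hd.integrable_norm_pow two_ne_zero).const_mul ((b : ℝ) / n)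
  have hih := (hh.integrable_norm_pow two_ne_zero).const_mul (1 - (b : ℝ) / n)
  rw [← integral_const_mul, ← integral_const_mul, ← integral_add hid hih]
  simp_rw [sargeTable_sub_memory_succ]
  refine hJ.integral_norm_sq_le k (φ := fun S ω => if i ∈ S
      then gradient (f i) (x (k + 1) ω) - gradient (f i) (x k ω)
      else sargeTable f b (fun l => x l ω) (fun l => J l ω) k i
        - ((b : ℝ) / n) • sargeMemory f (fun l => x l ω) (fun l => J l ω) k i)
    (fun S => ?_) (fun S => ?_) (hid.add hih) fun ω => ?_
  · split_ifs
    · exact (hG' i k).fun_sub (hG i k)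
    · exact (stronglyMeasurable_sargeTable hJ hG hG' k i).fun_sub
        ((stronglyMeasurable_sargeMemory hJ hG k i).fun_const_smul _)
  · split_ifs
    · exact hd
    · exact hh
  · simp only [apply_ite norm, ite_pow]
    rw [subsetAverage_ite_mem hb hbn]
    exact le_rfl

theorem integral_error_sq_succ_le (hdiff : ∀ i, Differentiable ℝ (f i)) (hb : 1 ≤ b)
    (hbn : b ≤ n) (hJ : IsMinibatchSampling μ ℱ b J)
    (hG : ∀ i k, StronglyMeasurable[ℱ k] fun ω => gradient (f i) (x k ω))
    (hG' : ∀ i k, StronglyMeasurable[ℱ k] fun ω => gradient (f i) (x (k + 1) ω))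
    (hx2 : ∀ i k, MemLp (fun ω => gradient (f i) (x k ω)) 2 μ) (k : ℕ) :
    ∫ ω, ‖sarge f b (fun l => x l ω) (fun l => J l ω) (k + 1)
        - (1 / (n : ℝ)) • ∑ i, gradient (f i) (x (k + 1) ω)‖ ^ 2 ∂μ
      ≤ 1 / (b * n) * ∑ i, 3 * (∫ ω, ‖gradient (f i) (x (k + 1) ω)
            - gradient (f i) (x k ω)‖ ^ 2 ∂μ
          + ∫ ω, ‖sargeTable f b (fun l => x l ω) (fun l => J l ω) k i
            - ((b : ℝ) / n) • sargeMemory f (fun l => x l ω) (fun l => J l ω) k i‖ ^ 2 ∂μ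
          + ((b : ℝ) / n) ^ 2 * ∫ ω, ‖gradient (f i) (x k ω)
            - sargeMemory f (fun l => x l ω) (fun l => J l ω) k i‖ ^ 2 ∂μ)
        + (1 - (b : ℝ) / n) ^ 2 * ∫ ω, ‖sarge f b (fun l => x l ω) (fun l => J l ω) k
          - (1 / (n : ℝ)) • ∑ i, gradient (f i) (x k ω)‖ ^ 2 ∂μ := by
  have hg := memLp_sarge hdiff hJ hx2 k
  have hiD : ∀ i, Integrable (fun ω =>
      ‖sargeInnovation f b (fun l => x l ω) (fun l => J l ω) k i‖ ^ 2) μ := fun i =>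
    (memLp_sargeInnovation hJ hx2 k i).integrable_norm_pow two_ne_zero
  have hid : ∀ i, Integrable (fun ω =>
      ‖gradient (f i) (x (k + 1) ω) - gradient (f i) (x k ω)‖ ^ 2) μ := fun i =>
    ((hx2 i (k + 1)).fun_sub (hx2 i k)).integrable_norm_pow two_ne_zero
  have hih : ∀ i, Integrable (fun ω => ‖sargeTable f b (fun l => x l ω) (fun l => J l ω) k i
      - ((b : ℝ) / n) • sargeMemory f (fun l => x l ω) (fun l => J l ω) k i‖ ^ 2) μ := fun i =>
    ((memLp_sargeTable hJ hx2 k i).fun_sub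
      ((memLp_sargeMemory hJ hx2 k i).fun_const_smul _)).integrable_norm_pow two_ne_zero
  have hir : ∀ i, Integrable (fun ω => ((b : ℝ) / n) ^ 2 * ‖gradient (f i) (x k ω)
      - sargeMemory f (fun l => x l ω) (fun l => J l ω) k i‖ ^ 2) μ := fun i =>
    (((hx2 i k).fun_sub (memLp_sargeMemory hJ hx2 k i)).integrable_norm_pow
      two_ne_zero).const_mul _
  have hie : Integrable (fun ω => (1 - (b : ℝ) / n) ^ 2
      * ‖sarge f b (fun l => x l ω) (fun l => J l ω) k
        - (1 / (n : ℝ)) • ∑ i, gradient (f i) (x k ω)‖ ^ 2) μ :=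
    ((hg.fun_sub (memLp_mean_gradient hx2 k)).integrable_norm_pow two_ne_zero).const_mul _
  have hiS : Integrable (fun ω => 1 / ((b : ℝ) * n) * ∑ i,
      ‖sargeInnovation f b (fun l => x l ω) (fun l => J l ω) k i‖ ^ 2) μ :=
    (integrable_finsetSum _ fun i _ => hiD i).const_mul _
  have h1 : ∫ ω, ‖sarge f b (fun l => x l ω) (fun l => J l ω) (k + 1)
        - (1 / (n : ℝ)) • ∑ i, gradient (f i) (x (k + 1) ω)‖ ^ 2 ∂μ
      ≤ ∫ ω, (1 / ((b : ℝ) * n) * ∑ i,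
          ‖sargeInnovation f b (fun l => x l ω) (fun l => J l ω) k i‖ ^ 2
        + (1 - (b : ℝ) / n) ^ 2 * ‖sarge f b (fun l => x l ω) (fun l => J l ω) k
          - (1 / (n : ℝ)) • ∑ i, gradient (f i) (x k ω)‖ ^ 2) ∂μ := by
    simp_rw [sarge_succ_eq_stepError, add_sub_cancel_left]
    refine hJ.integral_norm_sq_le k
      (stronglyMeasurable_sargeStepError hJ hG hG' (stronglyMeasurable_sarge hdiff hJ hG hG' k))
      (memLp_sargeStepError hJ hx2 hg) (hiS.add hie) fun ω => ?_
    unfold sargeStepError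
    refine (subsetAverage_norm_batch_error_sq_le hb hbn _ _).trans_eq ?_
    rw [norm_smul, mul_pow, Real.norm_eq_abs, sq_abs]
  refine h1.trans ?_
  rw [integral_add hiS hie, integral_const_mul, integral_const_mul,
    integral_finsetSum _ fun i _ => hiD i]
  gcongr with i
  have hidh := (hid i).fun_add (hih i)
  rw [← integral_const_mul, ← integral_add (hid i) (hih i), ← integral_add hidh (hir i),
    ← integral_const_mul]
  exact integral_mono (hiD i) ((hidh.fun_add (hir i)).const_mul 3) fun ω =>
    norm_sargeInnovation_sq_le k i

theorem condExp_sarge_succ (hdiff : ∀ i, Differentiable ℝ (f i)) (hb : 1 ≤ b) (hbn : b ≤ n)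
    (hJ : IsMinibatchSampling μ ℱ b J)
    (hG : ∀ i k, StronglyMeasurable[ℱ k] fun ω => gradient (f i) (x k ω))
    (hG' : ∀ i k, StronglyMeasurable[ℱ k] fun ω => gradient (f i) (x (k + 1) ω))
    (hx2 : ∀ i k, MemLp (fun ω => gradient (f i) (x k ω)) 2 μ) (k : ℕ) :
    μ[fun ω => sarge f b (fun l => x l ω) (fun l => J l ω) (k + 1) | ℱ k] =ᵐ[μ] fun ω =>
      (1 / (n : ℝ)) • ∑ i, gradient (f i) (x (k + 1) ω) + (1 - (b : ℝ) / n) •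
        (sarge f b (fun l => x l ω) (fun l => J l ω) k
          - (1 / (n : ℝ)) • ∑ i, gradient (f i) (x k ω)) := by
  simp_rw [sarge_succ_eq_stepError]
  have hb' : (b : ℝ) ≠ 0 := by exact_mod_cast (by lia : b ≠ 0)
  refine (hJ.condExp_eq k (φ := fun S ω => (1 / (n : ℝ)) • ∑ i, gradient (f i) (x (k + 1) ω)
    + sargeStepError f b x J k S ω) (fun S => ?_) fun S => ?_).trans
    (Filter.Eventually.of_forall fun ω => ?_)
  · exact (stronglyMeasurable_mean_gradient fun i => hG' i k).fun_add
      (stronglyMeasurable_sargeStepError hJ hG hG' (stronglyMeasurable_sarge hdiff hJ hG hG' k) S)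
  · exact ((memLp_mean_gradient hx2 (k + 1)).fun_add
      (memLp_sargeStepError hJ hx2 (memLp_sarge hdiff hJ hx2 k) S)).integrable (by norm_num)
  · simp only [sargeStepError, sub_eq_add_neg]
    -- The batch mean of the innovations averages to their full mean, so the two cancel and only the
    -- damped old error remains.
    rw [subsetAverage_add, subsetAverage_add, subsetAverage_add, subsetAverage_smul (1 / (b : ℝ)),
      subsetAverage_sum_mem hb hbn, subsetAverage_const hbn, subsetAverage_const hbn,
      subsetAverage_const hbn, smul_smul, show 1 / (b : ℝ) * (b / n) = 1 / n by field_simp]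
    module

/-- The mean square error of SARGE is at most `12` times the discounted sum of the mean square
gradient differences. -/
theorem integral_error_sq_le_discountedSum (hdiff : ∀ i, Differentiable ℝ (f i)) (hb : 1 ≤ b)
    (hbn : (b : ℝ) ≤ (n : ℝ) / 3) (hJ : IsMinibatchSampling μ ℱ b J)
    (hG : ∀ i k, StronglyMeasurable[ℱ k] fun ω => gradient (f i) (x k ω))
    (hG' : ∀ i k, StronglyMeasurable[ℱ k] fun ω => gradient (f i) (x (k + 1) ω))
    (hx2 : ∀ i k, MemLp (fun ω => gradient (f i) (x k ω)) 2 μ) (k : ℕ) :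
    ∫ ω, ‖sarge f b (fun l => x l ω) (fun l => J l ω) k
        - (1 / (n : ℝ)) • ∑ i, gradient (f i) (x k ω)‖ ^ 2 ∂μ
      ≤ 12 * discountedSum (1 - (b : ℝ) / n / 2) (meanSqGradDiff μ f x) k := by
  have hb1 : (1 : ℝ) ≤ b := by exact_mod_cast hb
  have hn : (0 : ℝ) < n := by linarith
  have hbn' : b ≤ n := by
    have : (b : ℝ) ≤ n := by linarith
    exact_mod_cast this
  have hp : 0 < (b : ℝ) / n := by positivity
  have hp3 : (b : ℝ) / n ≤ 1 / 3 := by rw [div_le_iff₀ hn]; linarith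
  refine error_le_discountedSum hp hp3 hb1
    (v := fun k => ∫ ω, ‖sarge f b (fun l => x l ω) (fun l => J l ω) k
      - (1 / (n : ℝ)) • ∑ i, gradient (f i) (x k ω)‖ ^ 2 ∂μ)
    (H := fun k => (1 / (n : ℝ)) * ∑ i,
      ∫ ω, ‖sargeTable f b (fun l => x l ω) (fun l => J l ω) k i
        - ((b : ℝ) / n) • sargeMemory f (fun l => x l ω) (fun l => J l ω) k i‖ ^ 2 ∂μ)
    (R := fun k => (1 / (n : ℝ)) * ∑ i, ∫ ω, ‖gradient (f i) (x k ω)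
        - sargeMemory f (fun l => x l ω) (fun l => J l ω) k i‖ ^ 2 ∂μ)
    meanSqGradDiff_nonneg ?_ ?_ ?_ (fun k => ?_) (fun k => ?_) (fun k => ?_) (fun k => ?_) k
  -- Error, stored difference and age all vanish at time `0`: estimator, table and memory are
  -- initialised with exact gradients at `x₀`.
  · simp [sarge, gradient_finiteSum hdiff]
  · simp [sargeTable_sub_memory_zero]
  · simp [sargeMemory]
  · refine (mul_le_mul_of_nonneg_left (Finset.sum_le_sum fun i _ =>
      integral_storedDiff_sq_succ_le hb hbn' hJ hG hG' hx2 k i) (by positivity)).trans_eq ?_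
    rw [Finset.sum_add_distrib, ← Finset.mul_sum, ← Finset.mul_sum, meanSqGradDiff]
    ring
  · exact mul_nonneg (by positivity)
      (Finset.sum_nonneg fun _ _ => integral_nonneg fun _ => by positivity)
  · refine (mul_le_mul_of_nonneg_left (Finset.sum_le_sum fun i _ =>
      integral_age_sq_succ_le hb hbn' hJ hG hG' hx2 k i) (by positivity)).trans_eq ?_
    rw [Finset.sum_add_distrib, ← Finset.mul_sum, ← Finset.mul_sum, meanSqGradDiff]
    ring
  · refine (integral_error_sq_succ_le hdiff hb hbn' hJ hG hG' hx2 k).trans_eq ?_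
    rw [← Finset.mul_sum, Finset.sum_add_distrib, Finset.sum_add_distrib, ← Finset.mul_sum,
      meanSqGradDiff]
    field_simp

end Moments

/-! ### Assembly of the MSEB property. -/

theorem proposition4 {Ω : Type*} [MeasurableSpace Ω] (μ : Measure Ω) [IsProbabilityMeasure μ]
    (ℱ : Filtration ℕ ‹MeasurableSpace Ω›) {n m : ℕ} (b : ℕ) (hb : 1 ≤ b)
    (hbn : (b : ℝ) ≤ (n : ℝ) / 3)
    (f : Fin n → EuclideanSpace ℝ (Fin m) → ℝ) (L : ℝ≥0)
    (hconv : ∀ i, ConvexOn ℝ Set.univ (f i))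
    (hdiff : ∀ i, Differentiable ℝ (f i))
    (hlip : ∀ i, LipschitzWith L (gradient (f i)))
    (J : ℕ → Ω → Finset (Fin n)) (hJ : IsMinibatchSampling μ ℱ b J)
    (x : ℕ → Ω → EuclideanSpace ℝ (Fin m))
    (hx0 : StronglyMeasurable[ℱ 0] (x 0))
    (hx : ∀ k, StronglyMeasurable[ℱ k] (x (k + 1)))
    (hx2 : ∀ i k, MemLp (fun ω => gradient (f i) (x k ω)) 2 μ) :
    IsMSEB μ ℱ f x (fun k ω => sarge f b (fun l => x l ω) (fun l => J l ω) k)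
      12 ((27 + 12 * (b : ℝ)) / (n : ℝ) ^ 2)
      ((b : ℝ) / (2 * n)) ((b : ℝ) / n) ((b : ℝ) / (2 * n)) := by
  have hb1 : (1 : ℝ) ≤ b := by exact_mod_cast hb
  have hn : (0 : ℝ) < n := by linarith
  have hbn' : b ≤ n := by
    have : (b : ℝ) ≤ n := by linarith
    exact_mod_cast this
  have hp : (b : ℝ) / n ∈ Set.Ioc (0 : ℝ) 1 := ⟨by positivity, by
    rw [div_le_one hn]; linarith⟩
  have hp2 : (b : ℝ) / (2 * n) ∈ Set.Ioc (0 : ℝ) 1 := ⟨by positivity, by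
    rw [div_le_one (by positivity)]; linarith⟩
  have hhalf : (b : ℝ) / (2 * n) = b / n / 2 := by field_simp
  have hG' : ∀ i k, StronglyMeasurable[ℱ k] fun ω => gradient (f i) (x (k + 1) ω) :=
    fun i k => (hlip i).continuous.comp_stronglyMeasurable (hx k)
  have hG : ∀ i k, StronglyMeasurable[ℱ k] fun ω => gradient (f i) (x k ω) := by
    intro i k
    cases k with
    | zero => exact (hlip i).continuous.comp_stronglyMeasurable hx0
    | succ k => exact (hG' i k).mono (ℱ.mono k.le_succ)
  -- The bound already holds without the help of the terms weighted by `M₂`.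
  refine ⟨hx2, memLp_sarge hdiff hJ hx2, by norm_num, by positivity, hp2, hp, hp2, fun k => ?_,
    -- The index is shifted because `𝓜 k` bounds the error at `k + 1`. The convention `𝓜_{-1} = 0`
    -- matches `discountedSum` at `0`, and the required recursion holds with equality.
    fun k => 12 * discountedSum (1 - (b : ℝ) / n / 2) (meanSqGradDiff μ f x) (k + 1),
    fun _ => 0, fun k => ?_, ?_, fun k => ?_, fun k => ?_⟩
  · filter_upwards [condExp_sarge_succ hdiff hb hbn' hJ hG hG' hx2 k] with ω hω
    rw [hω, gradient_finiteSum hdiff, gradient_finiteSum hdiff]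
    module
  · simp_rw [gradient_finiteSum hdiff]
    exact integral_error_sq_le_discountedSum hdiff hb hbn hJ hG hG' hx2 (k + 1)
  · simp [discountedSum]
  · rw [hhalf]
    exact le_of_eq (by simp only [discountedSum]; ring)
  · refine Finset.sum_nonneg fun l _ => mul_nonneg (mul_nonneg (by positivity) ?_)
      (meanSqGradDiff_nonneg l)
    exact pow_nonneg (sub_nonneg.2 hp2.2) _
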